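/- Let $T>0$, $H\in(0,1)$, and let $X=(X_t)_{t\in[0,T]}$ be a centered Gaussian process on a probability space $(\Omega,\mathcal F,P)$ with covariance $$R(t,s)=\tfrac12\bigl(t^{2H}+s^{2H}-|t-s|^{2H}\bigr).$$ A Volterra representation of $X$ is a pair $(K,W)$, where $W$ is a standard Brownian motion on $[0,T]$ for some filtration $(\mathcal F_t)$ on $\Omega$ and $K$ is a deterministic kernel on $\{0\le s\le t\le T\}$ with $K(t,\cdot)\in L^2([0,t])$ for every $t$, such that $X_t=\int_0^t K(t,s)\,dW_s$ a.s. for every $t\in[0,T]$. (Kernels satisfying the Decreusefond–Üstünel conditions, in particular joint measurability and $|K(t,s)|\le C|t-s|^{h-1/2}$ for some $h\in(0,1)$, are of this kind.) Given $(K,W)$: - $k_t:=K(t,\cdot)\mathbf 1_{[0,t]}$, and $\mathcal H_K$ is the closed linear span of $\{k_t : t\in[0,T]\}$ in $L^2([0,T])$, so that $\langle k_t,k_u\rangle=\int_0^{t\wedge u}K(t,s)K(u,s)\,ds$; $\mathcal H_K^t$ is the closed linear span of $\{k_s : s\le t\}$. - $D^K$ is the Malliavin derivative: the closure, as an operator from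 $L^2(\Omega)$ to $L^2(\Omega;\mathcal H_K)$, of $f(X_{t_1},\dots,X_{t_n})\mapsto\sum_i\partial_if(X_{t_1},\dots,X_{t_n})\,k_{t_i}$, where $f$ is smooth with all derivatives of polynomial growth. - $\Pi^K$ is the causal projection in either of two senses: (a) at time $t$, the orthogonal projection of $\mathcal H_K$ onto $\mathcal H_K^t$, applied pointwise in $\omega$; (b) the predictable projection, i.e. the orthogonal projection of $L^2(\Omega;\mathcal H_K)$ onto the closed subspace of fields $u$ whose projection onto $\mathcal H^t_K$ is $\mathcal F_t$-measurable (up to null sets) for every $t$. - The intrinsic bracket is $\langle X\rangle^{(D^K,\Pi^K)}_t:=\|\Pi^KD^KX_t\|_{\mathcal H_K}^2$. Then, for every Volterra representation $(K,W)$ of $X$ and either choice of $\Pi^K$: 1. the bracket is well defined, i.e. $X_t\in\mathrm{Dom}(D^K)$ for every $t\in[0,T]$ and $t\mapsto\Pi^KD^KX_t$ lies in $L^2([0,T];L^2(\Omega;\mathcal H_K))$; 2. for every $t\in[0,T]$, almost surely $\langle X\rangle^{(D^K,\Pi^K)}_t=R(t,t)=t^{2H}$; 3. $H$ is characterized by the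 scaling of the bracket: if $\gamma$ is a deterministic function with $\langle X\rangle^{(D^K,\Pi^K)}_t=\gamma(t)$ a.s. for every $t\in[0,T]$, then for every real $H'$, $\gamma(t)\sim t^{2H'}$ as $t\to0^+$ if and only if $H'=H$. Moreover, this is independent of the representation: for any two Volterra representations $(K_1,W_1)$, $(K_2,W_2)$ of $X$ and any of the above choices of $\Pi^{K_1}$, $\Pi^{K_2}$, one has $\langle X\rangle^{(D^{K_1},\Pi^{K_1})}_t=\langle X\rangle^{(D^{K_2},\Pi^{K_2})}_t$ almost surely for every $t\in[0,T]$. -/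

import Mathlib

open MeasureTheory ProbabilityTheory Filter Topology

noncomputable section

/-- The time interval `[0, T]`. -/
abbrev TimeInterval (T : ℝ) : Type := Set.Icc (0 : ℝ) T

/-- Lebesgue measure on `[0, T]`. -/
abbrev lebesgue (T : ℝ) : Measure (TimeInterval T) := Measure.comap Subtype.val volume

/-! ### Volterra kernels and their Cameron-Martin spaces -/

/-- A deterministic Volterra kernel on `{0 ≤ s ≤ t ≤ T}`. Only the values `toFun t s` with `s ≤ t`
are ever used. Square integrability of each `K(t, ·)` on `[0, t]` is exactly what is needed for
`∫_0^t K(t, s) dW_s` to exist. -/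
structure VolterraKernel (T : ℝ) where
  toFun : TimeInterval T → TimeInterval T → ℝ
  memLp : ∀ t, MemLp ((Set.Iic t).indicator (toFun t)) 2 (lebesgue T)

namespace VolterraKernel

variable {T : ℝ} (K : VolterraKernel T)

/-- The slice `K(t, ·) 1_{[0, t]}` as an element of `L²([0, T])`. -/
def slice (t : TimeInterval T) : Lp ℝ 2 (lebesgue T) :=
  (K.memLp t).toLp _

/-- The Cameron-Martin space `ℋ_K`: the completion of the span of the `K(t, ·)` for the inner
product `⟪K(t, ·), K(u, ·)⟫ = ∫_0^{t ∧ u} K(t, s) K(u, s) ds`, realized as a closed subspace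
of `L²([0, T])`. -/
abbrev cameronMartin : Submodule ℝ (Lp ℝ 2 (lebesgue T)) :=
  (Submodule.span ℝ (Set.range K.slice)).topologicalClosure

/-- The canonical representer `k_t = K(t, ·) ∈ ℋ_K`. -/
def representer (t : TimeInterval T) : K.cameronMartin :=
  ⟨K.slice t, Submodule.le_topologicalClosure _ (Submodule.subset_span ⟨t, rfl⟩)⟩

/-- The closed span `ℋ_K^t` of the representers `k_s`, `s ≤ t`. -/
abbrev pastSpace (t : TimeInterval T) : Submodule ℝ K.cameronMartin :=
  (Submodule.span ℝ (K.representer '' Set.Iic t)).topologicalClosure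

end VolterraKernel

/-- Kernel conditions of Decreusefond-Üstünel type: (measurability and) square integrability on the
triangle, the bound `|K(t, s)| ≤ C |t - s| ^ (h - 1/2)` for some `h ∈ (0, 1)`, and existence
of `∂_t K(t, s)` for `s < t`. No integrability of the derivative is asked for.
By `SatisfiesDU.toVolterraKernel` every such kernel is a `VolterraKernel`. -/
structure SatisfiesDU {T : ℝ} (K : TimeInterval T → TimeInterval T → ℝ) : Prop where
  measurable : Measurable
    (Set.indicator {p : TimeInterval T × TimeInterval T | p.2 ≤ p.1} (Function.uncurry K))
  sq_integrable : MemLp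
    (Set.indicator {p : TimeInterval T × TimeInterval T | p.2 ≤ p.1} (Function.uncurry K)) 2
    ((lebesgue T).prod (lebesgue T))
  bound : ∃ h ∈ Set.Ioo (0 : ℝ) 1, ∃ C : ℝ, ∀ t s : TimeInterval T, s < t →
    |K t s| ≤ C * |(t : ℝ) - s| ^ (h - 1 / 2)
  exists_deriv : ∀ (s t : TimeInterval T), s < t → ∃ d : ℝ,
    HasDerivWithinAt (fun u : ℝ => K (Set.projIcc 0 T (s.2.1.trans s.2.2) u) s) d
      (Set.Ioc (s : ℝ) T) t

theorem SatisfiesDU.memLp_slice {T : ℝ} {K : TimeInterval T → TimeInterval T → ℝ}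
    (hK : SatisfiesDU K) (t : TimeInterval T) :
    MemLp ((Set.Iic t).indicator (K t)) 2 (lebesgue T) := by
  obtain ⟨h, ⟨h0, h1⟩, C, hC⟩ := hK.bound
  have hmeas : Measurable ((Set.Iic t).indicator (K t)) :=
    hK.measurable.comp (measurable_const.prodMk measurable_id : Measurable (fun s => (t, s)))
  rw [memLp_two_iff_integrable_sq hmeas.aestronglyMeasurable]
  have hint : Integrable (fun s : TimeInterval T => C ^ 2 * |(t : ℝ) - s| ^ (2 * h - 1))
      (lebesgue T) := by
    refine Integrable.const_mul ?_ _
    have key : IntegrableOn (fun s : ℝ => |(t : ℝ) - s| ^ (2 * h - 1)) (Set.Icc 0 T) := by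
      have e1 : IntervalIntegrable (fun s : ℝ => |s| ^ (2 * h - 1)) volume ((t : ℝ) - 0)
          ((t : ℝ) - T) := by
        have f1 : ∀ a b : ℝ, IntervalIntegrable (fun s : ℝ => |s| ^ (2 * h - 1)) volume a b := by
          have pos : ∀ b : ℝ, 0 ≤ b →
              IntervalIntegrable (fun s : ℝ => |s| ^ (2 * h - 1)) volume 0 b := by
            intro b hb
            refine (intervalIntegral.intervalIntegrable_rpow' (r := 2 * h - 1)
              (by linarith) : IntervalIntegrable _ volume 0 b).congr ?_
            intro x hx
            rw [Set.uIoc_of_le hb] at hx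
            simp [abs_of_pos hx.1]
          have zero : ∀ b : ℝ,
              IntervalIntegrable (fun s : ℝ => |s| ^ (2 * h - 1)) volume 0 b := by
            intro b
            rcases le_total 0 b with hb | hb
            · exact pos b hb
            · have := (IntervalIntegrable.iff_comp_neg (f := fun s : ℝ => |s| ^ (2 * h - 1))
                (a := 0) (b := b)).2 (by simpa using pos (-b) (by linarith))
              exact this
          intro a b
          exact (zero a).symm.trans (zero b)
        exact f1 _ _
      have e2 := e1.comp_sub_left (t : ℝ)
      simp only [sub_sub_cancel] at e2
      rw [intervalIntegrable_iff_integrableOn_Icc_of_le (t.2.1.trans t.2.2)] at e2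
      exact e2
    have := (integrableOn_iff_comap_subtypeVal
      (f := fun s : ℝ => |(t : ℝ) - s| ^ (2 * h - 1)) measurableSet_Icc).1 key
    exact this
  have hne : ∀ᵐ s ∂(lebesgue T), s ≠ t := by
    have : (lebesgue T) {t} = 0 := by
      rw [lebesgue, comap_subtype_coe_apply measurableSet_Icc]
      simp
    exact measure_eq_zero_iff_ae_notMem.1 this
  refine hint.mono' (hmeas.pow_const 2).aestronglyMeasurable ?_
  filter_upwards [hne] with s hs
  by_cases hst : s ≤ t
  · have hlt : s < t := lt_of_le_of_ne hst hs
    have hpos : 0 < |(t : ℝ) - s| := abs_pos.2 (sub_ne_zero.2 (ne_of_gt hlt))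
    have hb := hC t s hlt
    rw [Set.indicator_of_mem (show s ∈ Set.Iic t from hst), Real.norm_eq_abs, abs_pow]
    calc |K t s| ^ 2 ≤ (C * |(t : ℝ) - s| ^ (h - 1 / 2)) ^ 2 := by gcongr
      _ = C ^ 2 * |(t : ℝ) - s| ^ (2 * h - 1) := by
        rw [mul_pow, ← Real.rpow_natCast (|(t : ℝ) - s| ^ (h - 1 / 2)) 2, ← Real.rpow_mul hpos.le]
        congr 2
        push_cast
        ring
  · rw [Set.indicator_of_notMem (show s ∉ Set.Iic t from hst)]
    simp only [ne_eq, OfNat.ofNat_ne_zero, not_false_eq_true, zero_pow, norm_zero]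
    positivity

/-- Every kernel satisfying the Decreusefond-Üstünel conditions is a Volterra kernel. -/
def SatisfiesDU.toVolterraKernel {T : ℝ} {K : TimeInterval T → TimeInterval T → ℝ}
    (hK : SatisfiesDU K) : VolterraKernel T where
  toFun := K
  memLp := hK.memLp_slice

/-! ### Brownian motion and the Wiener integral -/

section Probability

variable {Ω : Type*} [mΩ : MeasurableSpace Ω] {T : ℝ}

/-- Standard Brownian motion on `[0, T]` relative to a filtration. -/
structure IsBrownianMotionOn (P : Measure Ω) (𝓕 : Filtration (TimeInterval T) mΩ)
    (W : TimeInterval T → Ω → ℝ) : Prop where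
  adapted : ∀ t, Measurable[𝓕 t] (W t)
  initial : ∀ t : TimeInterval T, (t : ℝ) = 0 → W t =ᵐ[P] 0
  indep_increment : ∀ s t, s ≤ t →
    Indep (MeasurableSpace.comap (fun ω => W t ω - W s ω) inferInstance) (𝓕 s) P
  law_increment : ∀ s t, s ≤ t →
    HasLaw (fun ω => W t ω - W s ω) (gaussianReal 0 (Real.toNNReal ((t : ℝ) - s))) P
  continuous_paths : ∀ᵐ ω ∂P, Continuous fun t => W t ω

/-- The Wiener integral `f ↦ ∫_0^T f dW` as the closed linear operator from `L²([0, T])` to `L²(Ω)`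
whose graph is the closure of the linear span of the pairs `(1_{[0, t]}, W_t)`. -/
def wienerIntegral (P : Measure Ω) (W : TimeInterval T → Ω → ℝ) :
    Lp ℝ 2 (lebesgue T) →ₗ.[ℝ] Lp ℝ 2 P :=
  (Submodule.span ℝ {p : Lp ℝ 2 (lebesgue T) × Lp ℝ 2 P |
    ∃ t : TimeInterval T, p.1 =ᵐ[lebesgue T] (Set.Iic t).indicator (fun _ => (1 : ℝ)) ∧
      p.2 =ᵐ[P] W t}).topologicalClosure.toLinearPMap

/-! ### The process and its Volterra representations -/

/-- A centered Gaussian process on `[0, T]` with covariance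
`R(t, s) = (t ^ (2H) + s ^ (2H) - |t - s| ^ (2H)) / 2`. -/
structure IsFBMType (P : Measure Ω) (H : ℝ) (X : TimeInterval T → Ω → ℝ) : Prop where
  gaussian : IsGaussianProcess X P
  centered : ∀ t, ∫ ω, X t ω ∂P = 0
  covariance : ∀ t s : TimeInterval T, cov[X t, X s; P] =
    1 / 2 * ((t : ℝ) ^ (2 * H) + (s : ℝ) ^ (2 * H) - |(t : ℝ) - s| ^ (2 * H))

theorem IsFBMType.memLp {P : Measure Ω} {H : ℝ} {X : TimeInterval T → Ω → ℝ}
    (hX : IsFBMType P H X) (t : TimeInterval T) : MemLp (X t) 2 P :=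
  (hX.gaussian.hasGaussianLaw_eval t).memLp_two

/-- The random variable `X_t` as an element of `L²(Ω)`. -/
def IsFBMType.toL2 {P : Measure Ω} {H : ℝ} {X : TimeInterval T → Ω → ℝ}
    (hX : IsFBMType P H X) (t : TimeInterval T) : Lp ℝ 2 P :=
  (hX.memLp t).toLp _

/-- A Volterra representation `X_t = ∫_0^t K(t, s) dW_s` of the process `X`: a kernel, a filtration
and a Brownian motion `W` for that filtration. -/
structure VolterraRepresentation (P : Measure Ω) (X : TimeInterval T → Ω → ℝ) where
  kernel : VolterraKernel T
  filtration : Filtration (TimeInterval T) mΩ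
  driver : TimeInterval T → Ω → ℝ
  isBrownianMotion : IsBrownianMotionOn P filtration driver
  represents : ∀ t, ∃ h : kernel.slice t ∈ (wienerIntegral P driver).domain,
    X t =ᵐ[P] wienerIntegral P driver ⟨kernel.slice t, h⟩

namespace VolterraRepresentation

variable {P : Measure Ω} {X : TimeInterval T → Ω → ℝ} (R : VolterraRepresentation P X)

/-- `L²(Ω; ℋ_K)`. -/
abbrev Fields : Type _ := Lp R.kernel.cameronMartin 2 P

/-- The pairs `(F, DF)` with `F = f(X_{t₁}, …, X_{tₙ})`, where `f` is smooth with all derivatives of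
polynomial growth, and `DF = ∑ᵢ ∂ᵢf(X_{t₁}, …, X_{tₙ}) k_{tᵢ}`. -/
def cylindricalGraph : Set (Lp ℝ 2 P × R.Fields) :=
  {p | ∃ (n : ℕ) (t : Fin n → TimeInterval T) (f : (Fin n → ℝ) → ℝ), f.HasTemperateGrowth ∧
    p.1 =ᵐ[P] (fun ω => f fun i => X (t i) ω) ∧
    p.2 =ᵐ[P] fun ω => ∑ i, fderiv ℝ f (fun j => X (t j) ω) (Pi.single i 1) •
      R.kernel.representer (t i)}

/-- The Malliavin derivative `D^K`: the closure, as an operator from `L²(Ω)` to `L²(Ω; ℋ_K)`, of the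
derivative on cylindrical functionals. -/
def malliavinDerivative : Lp ℝ 2 P →ₗ.[ℝ] R.Fields :=
  (Submodule.span ℝ R.cylindricalGraph).topologicalClosure.toLinearPMap

/-- The orthogonal projection of `ℋ_K` onto `ℋ_K^t`, applied pointwise to fields in
`L²(Ω; ℋ_K)`. -/
def pastProjection (t : TimeInterval T) : R.Fields →L[ℝ] R.Fields :=
  (R.kernel.pastSpace t).starProjection.compLpL 2 P

/-- The closed subspace of `L²(Ω; ℋ_K)` of adapted fields: those `u` for which, for every `t`, the
projection of `u` onto `ℋ_K^t` is measurable for the filtration at time `t`. -/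
abbrev adaptedFields : Submodule ℝ R.Fields :=
  (⨅ t : TimeInterval T, (lpMeas R.kernel.cameronMartin ℝ (R.filtration t) 2 P).comap
    (R.pastProjection t).toLinearMap).topologicalClosure

/-- The predictable projection as one operator on `L²(Ω; ℋ_K)`: the orthogonal projection onto the
adapted fields. -/
def predictableProjection : R.Fields →L[ℝ] R.Fields :=
  Submodule.starProjection (𝕜 := ℝ) (E := R.Fields) R.adaptedFields

/-- The causal projections `Π^K` of the representation, as families indexed by the time at which the
bracket is evaluated: the projections onto the spaces `ℋ_K^t`, and the predictable projection
(which does not depend on `t`). -/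
def causalProjections : Set (TimeInterval T → R.Fields →L[ℝ] R.Fields) :=
  {R.pastProjection, fun _ => R.predictableProjection}

end VolterraRepresentation

/-! ### The intrinsic bracket -/

section Bracket

variable {P : Measure Ω} {E : Type*} [NormedAddCommGroup E] [InnerProductSpace ℝ E]

open scoped Classical in
/-- The field `Π D Y_t` in `L²(Ω; E)` (with value `0` if `Y_t` is not in the domain of `D`). -/
def energyField (D : Lp ℝ 2 P →ₗ.[ℝ] Lp E 2 P) (proj : TimeInterval T → Lp E 2 P →L[ℝ] Lp E 2 P)
    (Y : TimeInterval T → Lp ℝ 2 P) (t : TimeInterval T) : Lp E 2 P :=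
  if h : Y t ∈ D.domain then proj t (D ⟨Y t, h⟩) else 0

/-- The conditions under which the intrinsic bracket is defined: every `Y_t` is in the domain of `D`
and `t ↦ Π D Y_t` is square integrable on `[0, T] × Ω`. -/
structure HasIntrinsicBracket (D : Lp ℝ 2 P →ₗ.[ℝ] Lp E 2 P)
    (proj : TimeInterval T → Lp E 2 P →L[ℝ] Lp E 2 P) (Y : TimeInterval T → Lp ℝ 2 P) : Prop where
  mem_domain : ∀ t, Y t ∈ D.domain
  memLp : MemLp (energyField D proj Y) 2 (lebesgue T)

/-- The intrinsic bracket `⟨Y⟩_t = ‖Π D Y_t‖²`, a random variable for each `t`. -/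
def intrinsicBracket (D : Lp ℝ 2 P →ₗ.[ℝ] Lp E 2 P)
    (proj : TimeInterval T → Lp E 2 P →L[ℝ] Lp E 2 P) (Y : TimeInterval T → Lp ℝ 2 P)
    (t : TimeInterval T) (ω : Ω) : ℝ :=
  ‖energyField D proj Y t ω‖ ^ 2

end Bracket

end Probability

end

/-! The variable `X_t` is a linear functional of the process, so `D^K X_t` is the deterministic
field `k_t`. Since `k_t` lies in `ℋ_K^t` and deterministic fields are adapted, both causal
projections fix it (`causalProjections_constantField`). The bracket is therefore `‖k_t‖²`, and the
Wiener isometry turns this into `E[X_t²] = t^(2H)` (`inner_representer`). This value involves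
neither `K` nor `W`, which gives independence of the representation; the scaling claim compares
powers of `t` at `0⁺`.

The real content is that `D^K` is an operator at all: the closed span of the cylindrical pairs must
be single-valued. This follows from the duality `E⟪V, DF⟫ = E[δ(V) F]` for fields `V = g(X) k_u`,
with `δ(V) = g(X) X_u - ⟪D g(X), k_u⟫` (`exists_divergence`). If `F = 0`, the limit of the
derivatives is orthogonal to all such `V`, yet lies in their closed span, so it vanishes. The
duality is Gaussian integration by parts, which reduces to Stein's lemma by regressing a Gaussian
vector on one variable. -/

noncomputable section

/-! ### Gaussian integration by parts -/

section GaussianIntegrationByParts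

/-- **Stein's lemma** for a one-dimensional centered Gaussian law. -/
theorem integral_mul_id_gaussianReal {v : NNReal} (hv : v ≠ 0) {φ φ' : ℝ → ℝ}
    (hφ : ∀ x, HasDerivAt φ (φ' x) x) (h₁ : Integrable φ (gaussianReal 0 v))
    (h₂ : Integrable (fun x => φ x * x) (gaussianReal 0 v))
    (h₃ : Integrable φ' (gaussianReal 0 v)) :
    ∫ x, φ x * x ∂gaussianReal 0 v = v * ∫ x, φ' x ∂gaussianReal 0 v := by
  have hv' : (v : ℝ) ≠ 0 := by exact_mod_cast hv
  -- For the density `p`, the function `-v p` is a primitive of `x p(x)`, so the identity is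
  -- integration by parts on the line; integrability of `φ p` disposes of the boundary terms.
  have hpdf : ∀ x, HasDerivAt (fun y => -((v : ℝ) * gaussianPDFReal 0 v y))
      (gaussianPDFReal 0 v x * x) x := by
    intro x
    have := (((((hasDerivAt_id x).pow 2).neg).div_const (2 * (v : ℝ))).exp.const_mul
      ((√(2 * Real.pi * v))⁻¹)).const_mul (v : ℝ) |>.neg
    have hfun : (fun y => -((v : ℝ) * gaussianPDFReal 0 v y)) =
        -fun y => (v : ℝ) * ((√(2 * Real.pi * v))⁻¹ * Real.exp ((-id ^ 2) y / (2 * (v : ℝ)))) := by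
      funext y
      simp [gaussianPDFReal]
    rw [hfun]
    refine this.congr_deriv ?_
    simp [gaussianPDFReal]
    field_simp
  have key : ∀ ψ : ℝ → ℝ, Integrable ψ (gaussianReal 0 v) →
      Integrable (fun x => gaussianPDFReal 0 v x * ψ x) := by
    intro ψ hψ
    rw [gaussianReal_of_var_ne_zero 0 hv, integrable_withDensity_iff_integrable_smul'
      (measurable_gaussianPDF 0 v) (ae_of_all _ fun x => gaussianPDF_lt_top)] at hψ
    simpa [toReal_gaussianPDF] using hψ
  have parts := integral_mul_deriv_eq_deriv_mul_of_integrable (u := φ) (u' := φ')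
    (v := fun y => -((v : ℝ) * gaussianPDFReal 0 v y)) (v' := fun x => gaussianPDFReal 0 v x * x)
    (fun x _ => hφ x) (fun x _ => hpdf x)
    ((key _ h₂).congr (ae_of_all _ fun x => by simp only [Pi.mul_apply]; ring))
    (((key _ h₃).const_mul (-(v : ℝ))).congr
      (ae_of_all _ fun x => by simp only [Pi.mul_apply]; ring))
    (((key _ h₁).const_mul (-(v : ℝ))).congr
      (ae_of_all _ fun x => by simp only [Pi.mul_apply]; ring))
  rw [integral_gaussianReal_eq_integral_smul hv, integral_gaussianReal_eq_integral_smul hv,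
    ← integral_const_mul]
  calc ∫ x, gaussianPDFReal 0 v x • (φ x * x)
      = ∫ x, φ x * (gaussianPDFReal 0 v x * x) := by
        congr 1; funext x; simp only [smul_eq_mul]; ring
    _ = _ := by
        rw [parts, ← integral_neg]
        congr 1; funext x; simp only [smul_eq_mul]; ring

/-- The derivative of a function of temperate growth has temperate growth. -/
theorem Function.HasTemperateGrowth.fderiv_apply {E F : Type*}
    [NormedAddCommGroup E] [NormedSpace ℝ E] [NormedAddCommGroup F] [NormedSpace ℝ F]
    {f : E → F} (hf : f.HasTemperateGrowth) (a : E) :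
    (fun x => _root_.fderiv ℝ f x a).HasTemperateGrowth := by
  have h : (_root_.fderiv ℝ f).HasTemperateGrowth := by
    refine ⟨(contDiff_infty_iff_fderiv.1 hf.1).2, fun n => ?_⟩
    obtain ⟨k, C, hC⟩ := hf.2 (n + 1)
    exact ⟨k, C, fun x => by rw [norm_iteratedFDeriv_fderiv]; exact hC x⟩
  exact (ContinuousLinearMap.hasTemperateGrowth (ContinuousLinearMap.apply ℝ F a)).comp h

variable {Ω E F : Type*} [MeasurableSpace Ω] {P : Measure Ω}
  [NormedAddCommGroup E] [NormedSpace ℝ E] [MeasurableSpace E] [BorelSpace E]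
  [SecondCountableTopology E] [CompleteSpace E] [NormedAddCommGroup F] [NormedSpace ℝ F]

theorem MeasureTheory.MemLp.pow_of_nonneg {g : Ω → ℝ} {p : ENNReal} {n : ℕ} (hn : n ≠ 0)
    (hg : MemLp g (p * n) P) (h0 : ∀ ω, 0 ≤ g ω) : MemLp (fun ω => g ω ^ n) p P := by
  have h := hg.norm_rpow_div (n : ENNReal)
  rw [ENNReal.mul_div_cancel_right (by exact_mod_cast hn) (ENNReal.natCast_ne_top n)] at h
  refine h.congr_norm (hg.aestronglyMeasurable.pow n) (ae_of_all _ fun ω => ?_)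
  rw [ENNReal.toReal_natCast, Real.rpow_natCast, Real.norm_of_nonneg (h0 ω)]

/-- A function of temperate growth of a Gaussian vector has moments of all orders. -/
theorem ProbabilityTheory.HasGaussianLaw.memLp_comp_of_hasTemperateGrowth {Y : Ω → E}
    (hY : HasGaussianLaw Y P) {f : E → F} (hf : f.HasTemperateGrowth) {p : ENNReal}
    (hp : p ≠ ⊤) : MemLp (fun ω => f (Y ω)) p P := by
  have := hY.isProbabilityMeasure
  obtain ⟨k, C, hC⟩ := hf.2 0
  -- The power `k + 1` instead of `k` keeps the exponent nonzero for `pow_of_nonneg`; nothing is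
  -- lost because `1 ≤ 1 + ‖Y‖`.
  have hq : p * (k + 1 : ℕ) ≠ ⊤ := ENNReal.mul_ne_top hp (ENNReal.natCast_ne_top _)
  have h1 : MemLp (fun ω => 1 + ‖Y ω‖) (p * (k + 1 : ℕ)) P := by
    generalize p * (k + 1 : ℕ) = q at hq
    have hm : MemLp Y q P := hY.memLp hq
    exact (memLp_const (1 : ℝ)).add hm.norm
  have h2 : MemLp (fun ω => C * (1 + ‖Y ω‖) ^ (k + 1)) p P :=
    (h1.pow_of_nonneg (Nat.succ_ne_zero k) fun ω => by positivity).const_mul C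
  refine h2.mono'
    (hf.1.continuous.comp_aestronglyMeasurable hY.aemeasurable.aestronglyMeasurable)
    (ae_of_all _ fun ω => ?_)
  have h3 := hC (Y ω)
  have hC0 : 0 ≤ C := by
    have := (norm_nonneg _).trans (hC 0)
    simpa using this
  rw [norm_iteratedFDeriv_zero] at h3
  exact h3.trans (mul_le_mul_of_nonneg_left
    (pow_le_pow_right₀ (by linarith [norm_nonneg (Y ω)]) (Nat.le_succ k)) hC0)

/-- **Gaussian integration by parts**: `E[f(Y) Z] = E[∂_a f(Y)]`, where `a` represents the
covariance between `Y` and the centered variable `Z`. -/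
theorem ProbabilityTheory.HasGaussianLaw.integral_comp_mul_eq_integral_fderiv {Y : Ω → E}
    {Z : Ω → ℝ} (h : HasGaussianLaw (fun ω => (Y ω, Z ω)) P) (hZ : ∫ ω, Z ω ∂P = 0) {a : E}
    (ha : ∀ L : StrongDual ℝ E, cov[L ∘ Y, Z; P] = L a) {f : E → ℝ} (hf : f.HasTemperateGrowth) :
    ∫ ω, f (Y ω) * Z ω ∂P = ∫ ω, fderiv ℝ f (Y ω) a ∂P := by
  have := h.isProbabilityMeasure
  have hZ2 : MemLp Z 2 P := h.snd.memLp_two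
  set v : NNReal := Var[Z; P].toNNReal with hv
  have hvar : (v : ℝ) = Var[Z; P] := Real.coe_toNNReal _ (variance_nonneg _ _)
  -- A degenerate `Z` vanishes almost surely, which forces `a = 0`. Otherwise the variance can be
  -- inverted.
  by_cases hv0 : v = 0
  · have hvar0 : Var[Z; P] = 0 := by rw [← hvar, hv0]; rfl
    have hZ0 : Z =ᵐ[P] 0 := by
      have := ae_eq_integral_of_variance_eq_zero hZ2 hvar0
      filter_upwards [this] with ω hω
      rw [hω, hZ]; rfl
    have ha0 : a = 0 := by
      refine (SeparatingDual.eq_zero_iff_forall_dual_eq_zero (R := ℝ) a).2 fun L => ?_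
      rw [← ha L, covariance]
      refine integral_eq_zero_of_ae ?_
      filter_upwards [hZ0] with ω hω
      simp [hω, hZ]
    subst ha0
    simp only [map_zero, integral_zero]
    refine integral_eq_zero_of_ae ?_
    filter_upwards [hZ0] with ω hω
    simp [hω]
  · have hv' : (v : ℝ) ≠ 0 := by exact_mod_cast hv0
    -- The residual of the regression of `Y` on `Z` is uncorrelated with `Z`, hence independent of
    -- it by joint Gaussianity. With `V` frozen, `f(Y)` depends on `Z` alone, along the direction
    -- `v⁻¹ a`.
    let V : Ω → E := fun ω => Y ω - Z ω • ((v : ℝ)⁻¹ • a)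
    let A : E × ℝ →L[ℝ] E × ℝ := (ContinuousLinearMap.fst ℝ E ℝ -
      (ContinuousLinearMap.snd ℝ E ℝ).smulRight ((v : ℝ)⁻¹ • a)).prod
      (ContinuousLinearMap.snd ℝ E ℝ)
    have hVZ : HasGaussianLaw (fun ω => (V ω, Z ω)) P := h.map_fun A
    have hind : IndepFun V Z P := by
      refine hVZ.indepFun_of_covariance_strongDual fun L M => ?_
      have hM : M ∘ Z = fun ω => M 1 * Z ω := by
        funext ω
        have : M (Z ω • 1) = Z ω • M 1 := map_smul _ _ _
        simpa [mul_comm] using this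
      have hL : L ∘ V = fun ω => (L ∘ Y) ω - ((v : ℝ)⁻¹ * L a) * Z ω := by
        funext ω
        simp [V]
        ring
      rw [hM, hL, covariance_const_mul_right, covariance_fun_sub_left
        (h.fst.map L).memLp_two (hZ2.const_mul _) hZ2, covariance_const_mul_left, ha,
        covariance_self hZ2.aemeasurable, ← hvar]
      field_simp
      simp
    have hVm := hVZ.fst.aemeasurable
    have hZm := hVZ.snd.aemeasurable
    have hZlaw : P.map Z = gaussianReal 0 v := by
      rw [h.snd.map_eq_gaussianReal, hZ]
    have hprod : P.map (fun ω => (V ω, Z ω)) = (P.map V).prod (gaussianReal 0 v) := by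
      rw [← hZlaw]
      exact (indepFun_iff_map_prod_eq_prod_map_map hVm hZm).1 hind
    let c : E × ℝ → E := fun p => p.1 + p.2 • ((v : ℝ)⁻¹ • a)
    have hc : Continuous c := by fun_prop
    have hcY : ∀ ω, c (V ω, Z ω) = Y ω := fun ω => by simp [c, V]
    have hfd := hf.fderiv_apply a
    have transfer : ∀ g : E × ℝ → ℝ, Continuous g → ∀ k : Ω → ℝ, (∀ ω, g (V ω, Z ω) = k ω) →
        Integrable k P → Integrable g ((P.map V).prod (gaussianReal 0 v)) ∧
          ∫ ω, k ω ∂P = ∫ w, ∫ z, g (w, z) ∂gaussianReal 0 v ∂P.map V := by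
      intro g hg k hgk hk
      have hk' : k = fun ω => g (V ω, Z ω) := funext fun ω => (hgk ω).symm
      have hi : Integrable g ((P.map V).prod (gaussianReal 0 v)) := by
        rw [← hprod]
        rw [hk'] at hk
        exact (integrable_map_measure hg.aestronglyMeasurable hVZ.aemeasurable).2 hk
      refine ⟨hi, ?_⟩
      have := Measure.isProbabilityMeasure_map hVm
      rw [← integral_prod g hi, ← hprod, integral_map hVZ.aemeasurable hg.aestronglyMeasurable, hk']
    have fc := hf.1.continuous
    have hY := h.fst
    have i₁ : Integrable (fun ω => f (Y ω)) P :=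
      (hY.memLp_comp_of_hasTemperateGrowth hf (p := 1) (by simp)).integrable le_rfl
    have i₂ : Integrable (fun ω => f (Y ω) * Z ω) P :=
      (hY.memLp_comp_of_hasTemperateGrowth hf (p := 2) (by simp)).integrable_mul hZ2
    have i₃ : Integrable (fun ω => fderiv ℝ f (Y ω) a) P :=
      (hY.memLp_comp_of_hasTemperateGrowth hfd (p := 1) (by simp)).integrable le_rfl
    obtain ⟨j₁, -⟩ := transfer (fun p => f (c p)) (fc.comp hc) _ (fun ω => by rw [hcY]) i₁
    obtain ⟨j₂, e₂⟩ := transfer (fun p => f (c p) * p.2) ((fc.comp hc).mul continuous_snd) _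
      (fun ω => by rw [hcY]) i₂
    obtain ⟨j₃, e₃⟩ := transfer (fun p => fderiv ℝ f (c p) a) (hfd.1.continuous.comp hc) _
      (fun ω => by rw [hcY]) i₃
    rw [e₂, e₃]
    have := Measure.isProbabilityMeasure_map hVm
    refine integral_congr_ae ?_
    filter_upwards [j₁.prod_right_ae, j₂.prod_right_ae, j₃.prod_right_ae] with w h₁ h₂ h₃
    -- The factor `v⁻¹` from the chain rule cancels the variance in Stein's lemma.
    have hder : ∀ z, HasDerivAt (fun z => f (c (w, z))) ((v : ℝ)⁻¹ * fderiv ℝ f (c (w, z)) a) z := by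
      intro z
      have hc' : HasDerivAt (fun z => c (w, z)) ((v : ℝ)⁻¹ • a) z := by
        simpa [c] using ((hasDerivAt_id z).smul_const ((v : ℝ)⁻¹ • a)).const_add w
      have := ((hf.1.differentiable (by simp)).differentiableAt
        (x := c (w, z))).hasFDerivAt.comp_hasDerivAt z hc'
      exact this.congr_deriv (by simp)
    rw [integral_mul_id_gaussianReal hv0 hder h₁ h₂ (h₃.const_mul _), integral_const_mul,
      mul_inv_cancel_left₀ hv']

end GaussianIntegrationByParts

/-! ### The Wiener isometry -/

/-- A continuous functional vanishing on a set vanishes on its closed span. -/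
theorem ContinuousLinearMap.apply_eq_zero_of_mem_topologicalClosure_span {A : Type*}
    [NormedAddCommGroup A] [NormedSpace ℝ A] {S : Set A} (φ : A →L[ℝ] ℝ) (h : ∀ x ∈ S, φ x = 0)
    {x : A} (hx : x ∈ (Submodule.span ℝ S).topologicalClosure) : φ x = 0 := by
  have hle : (Submodule.span ℝ S).topologicalClosure ≤ LinearMap.ker φ.toLinearMap :=
    Submodule.topologicalClosure_minimal _ (Submodule.span_le.2 h) φ.isClosed_ker
  exact hle hx

/-- If two components of pairs have the same inner products on a set, so do they on its closed
span. -/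
theorem inner_fst_eq_inner_snd_of_mem_topologicalClosure_span {A B : Type*}
    [NormedAddCommGroup A] [InnerProductSpace ℝ A] [NormedAddCommGroup B] [InnerProductSpace ℝ B]
    {S : Set (A × B)} (h : ∀ p ∈ S, ∀ q ∈ S, inner ℝ p.1 q.1 = inner ℝ p.2 q.2) {p q : A × B}
    (hp : p ∈ (Submodule.span ℝ S).topologicalClosure)
    (hq : q ∈ (Submodule.span ℝ S).topologicalClosure) :
    inner ℝ p.1 q.1 = inner ℝ p.2 q.2 := by
  let φ : A × B → A × B →L[ℝ] ℝ := fun p =>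
    (innerSL ℝ p.1).comp (ContinuousLinearMap.fst ℝ A B) -
      (innerSL ℝ p.2).comp (ContinuousLinearMap.snd ℝ A B)
  have hφ : ∀ p q, φ p q = inner ℝ p.1 q.1 - inner ℝ p.2 q.2 := fun p q => rfl
  -- The bilinear identity passes to the closed span one argument at a time.
  have h1 : ∀ p ∈ S, φ p q = 0 := fun p hp =>
    (φ p).apply_eq_zero_of_mem_topologicalClosure_span
      (fun x hx => by rw [hφ, h p hp x hx, sub_self]) hq
  have h2 : φ q p = 0 := (φ q).apply_eq_zero_of_mem_topologicalClosure_span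
    (fun x hx => by
      have := h1 x hx
      rw [hφ] at this ⊢
      rwa [real_inner_comm, real_inner_comm x.2]) hp
  rw [hφ, sub_eq_zero] at h2
  rwa [real_inner_comm, real_inner_comm q.2]

theorem lebesgue_Iic {T : ℝ} (t : TimeInterval T) : (lebesgue T) (Set.Iic t) = ENNReal.ofReal t := by
  rw [lebesgue, comap_subtype_coe_apply measurableSet_Icc]
  have : Subtype.val '' (Set.Iic t) = Set.Icc (0 : ℝ) t := by
    ext x
    simp only [Set.mem_image, Set.mem_Iic, Subtype.exists, exists_and_right, exists_eq_right,
      Set.mem_Icc]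
    exact ⟨fun ⟨hx, hxt⟩ => ⟨hx.1, hxt⟩, fun hx => ⟨⟨hx.1, hx.2.trans t.2.2⟩, hx.2⟩⟩
  rw [this, Real.volume_Icc, sub_zero]

instance isFiniteMeasure_lebesgue (T : ℝ) : IsFiniteMeasure (lebesgue T) := by
  refine ⟨?_⟩
  rw [lebesgue, comap_subtype_coe_apply measurableSet_Icc, Set.image_univ, Subtype.range_coe]
  exact measure_Icc_lt_top

namespace IsBrownianMotionOn

variable {Ω : Type*} [mΩ : MeasurableSpace Ω] {T : ℝ} {P : Measure Ω}
  {𝓕 : Filtration (TimeInterval T) mΩ} {W : TimeInterval T → Ω → ℝ}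

theorem hasLaw (hW : IsBrownianMotionOn P 𝓕 W) (t : TimeInterval T) :
    HasLaw (W t) (gaussianReal 0 (Real.toNNReal t)) P := by
  have h0 : (0 : ℝ) ≤ T := t.2.1.trans t.2.2
  have := hW.law_increment ⟨0, le_rfl, h0⟩ t t.2.1
  simp only [sub_zero] at this
  refine this.congr ?_
  filter_upwards [hW.initial ⟨0, le_rfl, h0⟩ rfl] with ω hω
  simp [hω]

theorem integral_sq (hW : IsBrownianMotionOn P 𝓕 W) (t : TimeInterval T) :
    ∫ ω, W t ω * W t ω ∂P = t := by
  have h := hW.hasLaw t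
  have h1 : ∫ ω, W t ω ∂P = 0 := by
    rw [h.integral_eq]; exact integral_id_gaussianReal
  have h2 : Var[W t; P] = t := by
    rw [h.variance_eq, variance_id_gaussianReal, Real.coe_toNNReal _ t.2.1]
  rw [variance_of_integral_eq_zero h.aemeasurable h1] at h2
  simpa [sq] using h2

theorem memLp_two (hW : IsBrownianMotionOn P 𝓕 W) (t : TimeInterval T) : MemLp (W t) 2 P :=
  (hW.hasLaw t).hasGaussianLaw.memLp_two

/-- Split `W_t W_s = (W_t - W_s) W_s + W_s²`: the increment is centered and independent of the past.
-/
theorem integral_mul_of_le (hW : IsBrownianMotionOn P 𝓕 W) {s t : TimeInterval T} (hst : s ≤ t) :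
    ∫ ω, W t ω * W s ω ∂P = s := by
  have hind : IndepFun (fun ω => W t ω - W s ω) (W s) P := by
    rw [IndepFun_iff_Indep]
    exact indep_of_indep_of_le_right (hW.indep_increment s t hst) (hW.adapted s).comap_le
  have hinc : ∫ ω, (W t ω - W s ω) ∂P = 0 := by
    rw [(hW.law_increment s t hst).integral_eq]; exact integral_id_gaussianReal
  have hms := (hW.memLp_two s)
  have hmt := (hW.memLp_two t)
  have h1 := hind.integral_mul_eq_mul_integral (hmt.sub hms).aestronglyMeasurable
    hms.aestronglyMeasurable
  have hd : Integrable (fun ω => (W t ω - W s ω) * W s ω) P := (hmt.sub hms).integrable_mul hms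
  have hs : Integrable (fun ω => W s ω * W s ω) P := hms.integrable_mul hms
  calc ∫ ω, W t ω * W s ω ∂P = ∫ ω, ((W t ω - W s ω) * W s ω + W s ω * W s ω) ∂P := by
        congr 1; funext ω; ring
    _ = s := by
        rw [integral_add hd hs, hW.integral_sq]
        have : ∫ ω, (W t ω - W s ω) * W s ω ∂P = 0 := by
          refine h1.trans ?_
          rw [hinc, zero_mul]
        rw [this, zero_add]

/-- Both sides equal `s ∧ t`, the length of the overlap of the intervals and the Brownian
covariance. -/
theorem inner_eq_inner (hW : IsBrownianMotionOn P 𝓕 W) {s t : TimeInterval T}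
    {f g : Lp ℝ 2 (lebesgue T)} {F G : Lp ℝ 2 P}
    (hf : f =ᵐ[lebesgue T] (Set.Iic s).indicator (fun _ => (1 : ℝ))) (hF : F =ᵐ[P] W s)
    (hg : g =ᵐ[lebesgue T] (Set.Iic t).indicator (fun _ => (1 : ℝ))) (hG : G =ᵐ[P] W t) :
    inner ℝ f g = inner ℝ F G := by
  wlog hst : s ≤ t generalizing s t f g F G
  · rw [real_inner_comm, real_inner_comm G]
    exact this hg hG hf hF (le_of_not_ge hst)
  rw [L2.inner_def, L2.inner_def]
  have h1 : ∫ ω, inner ℝ (F ω) (G ω) ∂P = s := by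
    rw [← hW.integral_mul_of_le hst]
    refine integral_congr_ae ?_
    filter_upwards [hF, hG] with ω h1 h2
    simp [h1, h2]
  rw [h1]
  have h2 : ∫ x, inner ℝ (f x) (g x) ∂lebesgue T =
      ∫ x, (Set.Iic s).indicator (fun _ => (1 : ℝ)) x ∂lebesgue T := by
    refine integral_congr_ae ?_
    filter_upwards [hf, hg] with x h1 h2
    rw [h1, h2]
    by_cases hx : x ≤ s
    · simp [Set.indicator, hx, hx.trans hst]
    · simp [Set.indicator, hx]
  rw [h2, integral_indicator_const _ measurableSet_Iic, Measure.real, lebesgue_Iic,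
    ENNReal.toReal_ofReal s.2.1]
  simp

/-- The Wiener integral is an isometry. -/
theorem inner_wienerIntegral (hW : IsBrownianMotionOn P 𝓕 W)
    (f g : (wienerIntegral P W).domain) :
    inner ℝ (wienerIntegral P W f) (wienerIntegral P W g) =
      inner ℝ (f : Lp ℝ 2 (lebesgue T)) (g : Lp ℝ 2 (lebesgue T)) := by
  set S := {p : Lp ℝ 2 (lebesgue T) × Lp ℝ 2 P |
    ∃ t : TimeInterval T, p.1 =ᵐ[lebesgue T] (Set.Iic t).indicator (fun _ => (1 : ℝ)) ∧
      p.2 =ᵐ[P] W t}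
  have hS : ∀ p ∈ S, ∀ q ∈ S, inner ℝ p.1 q.1 = inner ℝ p.2 q.2 := by
    rintro p ⟨s, hp1, hp2⟩ q ⟨t, hq1, hq2⟩
    exact hW.inner_eq_inner hp1 hp2 hq1 hq2
  -- Preservation of norms makes the closed span single-valued, so the values of `toLinearPMap`
  -- really lie on it.
  have hgraph : ∀ x ∈ (Submodule.span ℝ S).topologicalClosure, x.1 = 0 → x.2 = 0 := by
    intro x hx hx0
    have := inner_fst_eq_inner_snd_of_mem_topologicalClosure_span hS hx hx
    rw [hx0, inner_zero_left] at this
    exact inner_self_eq_zero.1 this.symm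
  exact (inner_fst_eq_inner_snd_of_mem_topologicalClosure_span hS
    (Submodule.mem_graph_toLinearPMap hgraph f) (Submodule.mem_graph_toLinearPMap hgraph g)).symm

end IsBrownianMotionOn

namespace VolterraRepresentation

variable {Ω : Type*} [MeasurableSpace Ω] {T : ℝ} {P : Measure Ω}
  {X : TimeInterval T → Ω → ℝ} (R : VolterraRepresentation P X)

/-- The isometry identifies the Gram matrix of the representers with the covariance of `X`. This is
the only use of the Brownian motion and of the representation identity. -/
theorem inner_representer {H : ℝ} (hX : IsFBMType P H X) (t s : TimeInterval T) :
    inner ℝ (R.kernel.representer t) (R.kernel.representer s) = cov[X t, X s; P] := by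
  obtain ⟨ht, et⟩ := R.represents t
  obtain ⟨hs, es⟩ := R.represents s
  have := hX.gaussian.isProbabilityMeasure
  rw [covariance_eq_sub (hX.memLp t) (hX.memLp s), hX.centered, zero_mul, sub_zero]
  have h := R.isBrownianMotion.inner_wienerIntegral ⟨_, ht⟩ ⟨_, hs⟩
  refine Eq.trans h.symm ?_
  rw [L2.inner_def]
  refine integral_congr_ae ?_
  filter_upwards [et, es] with ω h1 h2
  simp [← h1, ← h2, mul_comm]

end VolterraRepresentation

/-! ### Closability of the Malliavin derivative -/

theorem real_inner_smul_smul {A : Type*} [NormedAddCommGroup A] [InnerProductSpace ℝ A] (a b : ℝ)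
    (x y : A) : inner ℝ (a • x) (b • y) = a * b * inner ℝ x y := by
  rw [real_inner_smul_left, real_inner_smul_right, mul_assoc]

/-- A graph admitting an integration by parts formula against a total family of test vectors is
closable. -/
theorem snd_eq_zero_of_mem_topologicalClosure_span_of_adjoint {A B : Type*}
    [NormedAddCommGroup A] [InnerProductSpace ℝ A] [NormedAddCommGroup B] [InnerProductSpace ℝ B]
    {S : Set (A × B)} {D : Set B} (hS : ∀ p ∈ S, p.2 ∈ Submodule.span ℝ D)
    (hD : ∀ V ∈ D, ∃ δ : A, ∀ p ∈ S, inner ℝ V p.2 = inner ℝ δ p.1) {p : A × B}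
    (hp : p ∈ (Submodule.span ℝ S).topologicalClosure) (h0 : p.1 = 0) : p.2 = 0 := by
  -- The adjoint formula extends to the closure, where `p.1 = 0` makes `p.2` orthogonal to every
  -- test vector.
  have horth : ∀ V ∈ D, innerSL ℝ p.2 V = 0 := by
    intro V hV
    obtain ⟨δ, hδ⟩ := hD V hV
    let φ : A × B →L[ℝ] ℝ := (innerSL ℝ V).comp (ContinuousLinearMap.snd ℝ A B) -
      (innerSL ℝ δ).comp (ContinuousLinearMap.fst ℝ A B)
    have hφ : inner ℝ V p.2 - inner ℝ δ p.1 = 0 :=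
      φ.apply_eq_zero_of_mem_topologicalClosure_span
        (fun x hx => show inner ℝ V x.2 - inner ℝ δ x.1 = 0 by rw [hδ x hx, sub_self]) hp
    rwa [h0, inner_zero_right, sub_zero, real_inner_comm] at hφ
  -- But `p.2` is also a limit of combinations of test vectors, hence orthogonal to itself.
  have hle : (Submodule.span ℝ S).topologicalClosure ≤
      (Submodule.span ℝ D).topologicalClosure.comap (LinearMap.snd ℝ A B) :=
    Submodule.topologicalClosure_minimal _
      (Submodule.span_le.2 fun x hx => Submodule.le_topologicalClosure _ (hS x hx))
      ((Submodule.isClosed_topologicalClosure _).preimage continuous_snd)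
  exact inner_self_eq_zero.1
    ((innerSL ℝ p.2).apply_eq_zero_of_mem_topologicalClosure_span horth (hle hp))

/-! ### Integration by parts for finitely many values of a Gaussian process. -/

section GaussianProcess

variable {Ω τ ι : Type*} [MeasurableSpace Ω] {P : Measure Ω} {X : τ → Ω → ℝ} [Fintype ι]

/-- The times may repeat, so the vector is taken as a linear image of the values on the finite set
of distinct times. -/
theorem ProbabilityTheory.IsGaussianProcess.hasGaussianLaw_pi_prodMk (hX : IsGaussianProcess X P)
    (t : ι → τ) (u : τ) : HasGaussianLaw (fun ω => ((fun i => X (t i) ω), X u ω)) P := by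
  classical
  let I : Finset τ := insert u (Finset.univ.image t)
  let A : (I → ℝ) →L[ℝ] (ι → ℝ) × ℝ :=
    (ContinuousLinearMap.pi fun i =>
      ContinuousLinearMap.proj (R := ℝ) (φ := fun _ : I => ℝ) ⟨t i, by simp [I]⟩).prod
    (ContinuousLinearMap.proj (R := ℝ) (φ := fun _ : I => ℝ) ⟨u, by simp [I]⟩)
  exact (hX.hasGaussianLaw I).map_fun A

theorem ContinuousLinearMap.pi_apply_eq_sum {F : Type*} [NormedAddCommGroup F] [NormedSpace ℝ F]
    [DecidableEq ι] (L : (ι → ℝ) →L[ℝ] F) (x : ι → ℝ) :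
    L x = ∑ i, x i • L (Pi.single i 1) := by
  have := L.toLinearMap.pi_apply_eq_sum_univ x
  simp only [ContinuousLinearMap.coe_coe] at this
  rw [this]
  refine Finset.sum_congr rfl fun i _ => ?_
  congr 2
  funext j
  simp [Pi.single_apply, eq_comm]

/-- Integration by parts for functionals of finitely many values of a Gaussian process. -/
theorem ProbabilityTheory.IsGaussianProcess.integral_comp_mul_eq_integral_fderiv
    (hX : IsGaussianProcess X P) (t : ι → τ) (u : τ) (hu : ∫ ω, X u ω ∂P = 0)
    {f : (ι → ℝ) → ℝ} (hf : f.HasTemperateGrowth) :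
    ∫ ω, f (fun i => X (t i) ω) * X u ω ∂P =
      ∫ ω, fderiv ℝ f (fun i => X (t i) ω) (fun i => cov[X (t i), X u; P]) ∂P := by
  classical
  have := hX.isProbabilityMeasure
  refine (hX.hasGaussianLaw_pi_prodMk t u).integral_comp_mul_eq_integral_fderiv hu
    (fun L => ?_) hf
  have hL : L ∘ (fun ω i => X (t i) ω) = fun ω => ∑ i, X (t i) ω * L (Pi.single i 1) := by
    funext ω
    simpa using L.pi_apply_eq_sum (fun i => X (t i) ω)
  have h2 : ∀ s, MemLp (X s) 2 P := fun s => (hX.hasGaussianLaw_eval s).memLp_two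
  rw [hL, covariance_fun_sum_left (fun i => (h2 _).mul_const _) (h2 u), L.pi_apply_eq_sum]
  exact Finset.sum_congr rfl fun i _ => covariance_mul_const_left _

/-- Integration by parts for a product of functionals of a Gaussian process. -/
theorem ProbabilityTheory.IsGaussianProcess.integral_fderiv_mul_eq {κ : Type*} [Fintype κ]
    (hX : IsGaussianProcess X P) (t : ι → τ) (s : κ → τ) (u : τ) (hu : ∫ ω, X u ω ∂P = 0)
    {f : (ι → ℝ) → ℝ} (hf : f.HasTemperateGrowth) {g : (κ → ℝ) → ℝ} (hg : g.HasTemperateGrowth) :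
    ∫ ω, fderiv ℝ f (fun i => X (t i) ω) (fun i => cov[X (t i), X u; P]) *
        g (fun j => X (s j) ω) ∂P =
      ∫ ω, f (fun i => X (t i) ω) * (g (fun j => X (s j) ω) * X u ω -
        fderiv ℝ g (fun j => X (s j) ω) (fun j => cov[X (s j), X u; P])) ∂P := by
  let p₁ : (ι ⊕ κ → ℝ) →L[ℝ] (ι → ℝ) :=
    ContinuousLinearMap.pi fun i => ContinuousLinearMap.proj (R := ℝ) (Sum.inl i)
  let p₂ : (ι ⊕ κ → ℝ) →L[ℝ] (κ → ℝ) :=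
    ContinuousLinearMap.pi fun i => ContinuousLinearMap.proj (R := ℝ) (Sum.inr i)
  -- The product is one functional of the concatenated times, and Leibniz's rule splits its
  -- derivative into the two terms of the formula.
  have hh : (fun x => f (p₁ x) * g (p₂ x)).HasTemperateGrowth :=
    (hf.comp p₁.hasTemperateGrowth).mul (hg.comp p₂.hasTemperateGrowth)
  have key := hX.integral_comp_mul_eq_integral_fderiv (Sum.elim t s) u hu hh
  have hd : ∀ x a, fderiv ℝ (fun x => f (p₁ x) * g (p₂ x)) x a =
      fderiv ℝ f (p₁ x) (p₁ a) * g (p₂ x) + f (p₁ x) * fderiv ℝ g (p₂ x) (p₂ a) := by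
    intro x a
    have h1 := ((hf.1.differentiable (by simp)).differentiableAt
      (x := p₁ x)).hasFDerivAt.comp x p₁.hasFDerivAt
    have h2 := ((hg.1.differentiable (by simp)).differentiableAt
      (x := p₂ x)).hasFDerivAt.comp x p₂.hasFDerivAt
    have := (h1.mul h2).fderiv
    have e : (fun x => f (p₁ x) * g (p₂ x)) = (f ∘ p₁) * (g ∘ p₂) := rfl
    rw [e, this]
    simp
    ring
  simp only [hd] at key
  have hp₁ : ∀ ω, p₁ (fun i => X (Sum.elim t s i) ω) = fun i => X (t i) ω := fun ω => rfl
  have hp₂ : ∀ ω, p₂ (fun i => X (Sum.elim t s i) ω) = fun i => X (s i) ω := fun ω => rfl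
  have hc₁ : p₁ (fun i => cov[X (Sum.elim t s i), X u; P]) = fun i => cov[X (t i), X u; P] := rfl
  have hc₂ : p₂ (fun i => cov[X (Sum.elim t s i), X u; P]) = fun i => cov[X (s i), X u; P] := rfl
  simp only [hp₁, hp₂, hc₁, hc₂] at key
  have Lf : HasGaussianLaw (fun ω i => X (t i) ω) P := (hX.hasGaussianLaw_pi_prodMk t u).fst
  have Lg : HasGaussianLaw (fun ω i => X (s i) ω) P := (hX.hasGaussianLaw_pi_prodMk s u).fst
  have hgu : (fun x : (κ → ℝ) × ℝ => g x.1 * x.2).HasTemperateGrowth :=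
    (hg.comp (ContinuousLinearMap.fst ℝ (κ → ℝ) ℝ).hasTemperateGrowth).mul
      (ContinuousLinearMap.snd ℝ (κ → ℝ) ℝ).hasTemperateGrowth
  have mf := Lf.memLp_comp_of_hasTemperateGrowth hf (p := 2) (by simp)
  have mf' := Lf.memLp_comp_of_hasTemperateGrowth
    (hf.fderiv_apply (fun i => cov[X (t i), X u; P])) (p := 2) (by simp)
  have mg := Lg.memLp_comp_of_hasTemperateGrowth hg (p := 2) (by simp)
  have mg' := Lg.memLp_comp_of_hasTemperateGrowth
    (hg.fderiv_apply (fun i => cov[X (s i), X u; P])) (p := 2) (by simp)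
  have mgu := (hX.hasGaussianLaw_pi_prodMk s u).memLp_comp_of_hasTemperateGrowth hgu (p := 2)
    (by simp)
  have i₁ := mf'.integrable_mul mg
  have i₂ := mf.integrable_mul mg'
  have i₃ := mf.integrable_mul mgu
  have e₁ := integral_add i₁ i₂
  have e₂ := integral_sub i₃ i₂
  simp only [Pi.mul_apply] at e₁ e₂
  simp only [mul_sub]
  rw [e₂]
  simp only [← mul_assoc]
  rw [key, e₁]
  ring

end GaussianProcess

/-! ### Test fields and their divergence. -/

namespace VolterraRepresentation

variable {Ω : Type*} [MeasurableSpace Ω] {T : ℝ} {P : Measure Ω} {H : ℝ}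
  {X : TimeInterval T → Ω → ℝ} (R : VolterraRepresentation P X)

/-- The fields `g(X_{s₁}, …, X_{sₘ}) k_u` with `g` of temperate growth. -/
def elementaryFields : Set R.Fields :=
  {V | ∃ (m : ℕ) (s : Fin m → TimeInterval T) (g : (Fin m → ℝ) → ℝ) (u : TimeInterval T),
    g.HasTemperateGrowth ∧ V =ᵐ[P] fun ω => g (fun j => X (s j) ω) • R.kernel.representer u}

/-- Partial derivatives keep temperate growth, so each summand of `DF` is itself a test field. This
gives the totality needed for closability. -/
theorem snd_mem_span_elementaryFields (hX : IsFBMType P H X) {p : Lp ℝ 2 P × R.Fields}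
    (hp : p ∈ R.cylindricalGraph) : p.2 ∈ Submodule.span ℝ R.elementaryFields := by
  obtain ⟨n, t, f, hf, -, hp2⟩ := hp
  have hg : ∀ i, (fun x => fderiv ℝ f x (Pi.single i 1)).HasTemperateGrowth :=
    fun i => hf.fderiv_apply _
  have hm : ∀ i, MemLp (fun ω => fderiv ℝ f (fun j => X (t j) ω) (Pi.single i 1) •
      R.kernel.representer (t i)) 2 P := fun i =>
    (hX.gaussian.hasGaussianLaw_pi_prodMk t (t i)).fst.memLp_comp_of_hasTemperateGrowth
      ((hg i).smul (Function.HasTemperateGrowth.const (R.kernel.representer (t i)))) (by simp)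
  have hsum : p.2 = ∑ i, (hm i).toLp _ := by
    refine Lp.ext ?_
    have h1 : ∀ᵐ ω ∂P, ∀ i, (hm i).toLp _ ω = fderiv ℝ f (fun j => X (t j) ω) (Pi.single i 1) •
      R.kernel.representer (t i) := ae_all_iff.2 fun i => (hm i).coeFn_toLp
    filter_upwards [hp2, h1, Lp.coeFn_fun_finsetSum Finset.univ fun i => (hm i).toLp _]
      with ω h2 h3 h4
    rw [h2, h4]
    exact Finset.sum_congr rfl fun i _ => (h3 i).symm
  rw [hsum]
  exact Submodule.sum_mem _ fun i _ => Submodule.subset_span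
    ⟨n, t, _, t i, hg i, (hm i).coeFn_toLp⟩

/-- The duality between the derivative and the divergence of an elementary field. -/
theorem exists_divergence (hX : IsFBMType P H X) {V : R.Fields} (hV : V ∈ R.elementaryFields) :
    ∃ δ : Lp ℝ 2 P, ∀ p ∈ R.cylindricalGraph, inner ℝ V p.2 = inner ℝ δ p.1 := by
  obtain ⟨m, s, g, u, hg, hV⟩ := hV
  -- This is the divergence `g(X) X_u - ⟪D g(X), k_u⟫`, written as a function of the Gaussian vector
  -- so that temperate growth yields square integrability.
  have hgu : (fun x : (Fin m → ℝ) × ℝ => g x.1 * x.2 -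
      fderiv ℝ g x.1 (fun j => cov[X (s j), X u; P])).HasTemperateGrowth :=
    ((hg.comp (ContinuousLinearMap.fst ℝ (Fin m → ℝ) ℝ).hasTemperateGrowth).mul
      (ContinuousLinearMap.snd ℝ (Fin m → ℝ) ℝ).hasTemperateGrowth).sub
      ((hg.fderiv_apply _).comp (ContinuousLinearMap.fst ℝ (Fin m → ℝ) ℝ).hasTemperateGrowth)
  have hδ := (hX.gaussian.hasGaussianLaw_pi_prodMk s u).memLp_comp_of_hasTemperateGrowth hgu
    (p := 2) (by simp)
  refine ⟨hδ.toLp _, ?_⟩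
  rintro p ⟨n, t, f, hf, hp1, hp2⟩
  rw [L2.inner_def, L2.inner_def]
  calc ∫ ω, inner ℝ (V ω) (p.2 ω) ∂P
      = ∫ ω, fderiv ℝ f (fun i => X (t i) ω) (fun i => cov[X (t i), X u; P]) *
        g (fun j => X (s j) ω) ∂P := by
        refine integral_congr_ae ?_
        filter_upwards [hV, hp2] with ω h1 h2
        rw [h1, h2, inner_sum, ContinuousLinearMap.pi_apply_eq_sum, Finset.sum_mul]
        refine Finset.sum_congr rfl fun i _ => ?_
        refine (real_inner_smul_smul (A := R.kernel.cameronMartin) _ _ _ _).trans ?_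
        rw [R.inner_representer hX, covariance_comm]
        simp only [smul_eq_mul]
        ring
    _ = _ := hX.gaussian.integral_fderiv_mul_eq t s u (hX.centered u) hf hg
    _ = _ := by
        refine integral_congr_ae ?_
        filter_upwards [hp1, hδ.coeFn_toLp] with ω h1 h2
        rw [h1, h2]
        simp [mul_comm]

/-- The Malliavin derivative is closable. -/
theorem snd_eq_zero_of_mem_closure_cylindricalGraph (hX : IsFBMType P H X)
    {p : Lp ℝ 2 P × R.Fields}
    (hp : p ∈ (Submodule.span ℝ R.cylindricalGraph).topologicalClosure) (h0 : p.1 = 0) :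
    p.2 = 0 := by
  have closable := @snd_eq_zero_of_mem_topologicalClosure_span_of_adjoint (Lp ℝ 2 P) R.Fields
    _ _ _ _ R.cylindricalGraph R.elementaryFields fun _ => R.snd_mem_span_elementaryFields hX
  exact closable (fun _ => R.exists_divergence hX) hp h0

end VolterraRepresentation

/-! ### The intrinsic bracket of the process -/

/-- Powers of the variable are equivalent at `0⁺` only if the exponents agree. -/
theorem isEquivalent_rpow_rpow_nhdsGT_zero_iff {a b : ℝ} :
    Asymptotics.IsEquivalent (𝓝[>] (0 : ℝ)) (fun t => t ^ a) (fun t => t ^ b) ↔ a = b := by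
  refine ⟨fun h => ?_, fun h => h ▸ Asymptotics.IsEquivalent.refl⟩
  have hpos : ∀ᶠ t : ℝ in 𝓝[>] (0 : ℝ), 0 < t := eventually_mem_nhdsWithin
  have h1 : Tendsto (fun t : ℝ => t ^ (a - b)) (𝓝[>] (0 : ℝ)) (𝓝 1) := by
    refine ((Asymptotics.isEquivalent_iff_tendsto_one ?_).1 h).congr' ?_
    · filter_upwards [hpos] with t ht using (Real.rpow_pos_of_pos ht b).ne'
    · filter_upwards [hpos] with t ht
      simp [Real.rpow_sub ht]
  rcases lt_trichotomy a b with hab | hab | hab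
  · have h2 : Tendsto (fun t : ℝ => t ^ (a - b)) (𝓝[>] (0 : ℝ)) atTop :=
      tendsto_rpow_neg_nhdsGT_zero (by linarith)
    exact absurd h1 (not_tendsto_nhds_of_tendsto_atTop h2 1)
  · exact hab
  · have h2 : Tendsto (fun t : ℝ => t ^ (a - b)) (𝓝[>] (0 : ℝ)) (𝓝 0) := by
      have hc := (Real.continuousAt_rpow_const 0 (a - b) (Or.inr (by linarith))).tendsto
      rw [Real.zero_rpow (by linarith)] at hc
      exact hc.mono_left nhdsWithin_le_nhds
    exact absurd (tendsto_nhds_unique h1 h2) one_ne_zero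

namespace VolterraRepresentation

variable {Ω : Type*} [MeasurableSpace Ω] {T : ℝ} {P : Measure Ω} {H : ℝ}
  {X : TimeInterval T → Ω → ℝ} (R : VolterraRepresentation P X)

/-- Positivity of `H` makes the term `|t - t|^(2H)` vanish. -/
theorem norm_representer_sq (hX : IsFBMType P H X) (hH : 0 < H) (t : TimeInterval T) :
    ‖R.kernel.representer t‖ ^ 2 = (t : ℝ) ^ (2 * H) := by
  have h := R.inner_representer hX t t
  rw [hX.covariance, sub_self, abs_zero, Real.zero_rpow (by positivity)] at h
  rw [← real_inner_self_eq_norm_sq, h]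
  ring

theorem norm_representer_sub_sq (hX : IsFBMType P H X) (hH : 0 < H) (t s : TimeInterval T) :
    ‖R.kernel.representer t - R.kernel.representer s‖ ^ 2 = |(t : ℝ) - s| ^ (2 * H) := by
  have h := R.inner_representer hX t s
  rw [hX.covariance] at h
  rw [norm_sub_sq_real, h, R.norm_representer_sq hX hH, R.norm_representer_sq hX hH]
  ring

/-- The increments have norm `|t - s|^H`; continuity supplies the measurability in `t` required of
the bracket. -/
theorem continuous_representer (hX : IsFBMType P H X) (hH : 0 < H) :
    Continuous R.kernel.representer := by
  refine continuous_iff_continuousAt.2 fun s => tendsto_iff_norm_sub_tendsto_zero.2 ?_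
  have hn : ∀ t, ‖R.kernel.representer t - R.kernel.representer s‖ =
      √(|(t : ℝ) - s| ^ (2 * H)) := fun t => by
    rw [← R.norm_representer_sub_sq hX hH, Real.sqrt_sq (norm_nonneg _)]
  have hc : Continuous fun t : TimeInterval T => √(|(t : ℝ) - s| ^ (2 * H)) := by
    refine Real.continuous_sqrt.comp (Continuous.rpow_const (by fun_prop) fun _ => Or.inr ?_)
    positivity
  refine (hc.tendsto' s 0 ?_).congr fun t => (hn t).symm
  rw [sub_self, abs_zero, Real.zero_rpow (by positivity), Real.sqrt_zero]

variable [IsProbabilityMeasure P]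

/-- The deterministic field `k_t`. -/
def constantField (t : TimeInterval T) : R.Fields :=
  Lp.const 2 P (R.kernel.representer t)

theorem coeFn_constantField (t : TimeInterval T) :
    R.constantField t =ᵐ[P] fun _ => R.kernel.representer t :=
  Lp.coeFn_const 2 P _

theorem mem_cylindricalGraph (hX : IsFBMType P H X) (t : TimeInterval T) :
    (hX.toL2 t, R.constantField t) ∈ R.cylindricalGraph := by
  let f : (Fin 1 → ℝ) →L[ℝ] ℝ := ContinuousLinearMap.proj (R := ℝ) 0
  refine ⟨1, fun _ => t, f, f.hasTemperateGrowth, (hX.memLp t).coeFn_toLp, ?_⟩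
  filter_upwards [R.coeFn_constantField t] with ω hω
  rw [hω]
  simp [f]

/-- Even this explicit value rests on closability: only then does the graph of the operator coincide
with the closed span containing the cylindrical pair. -/
theorem malliavinDerivative_toL2 (hX : IsFBMType P H X) (t : TimeInterval T) :
    ∃ h : hX.toL2 t ∈ R.malliavinDerivative.domain,
      R.malliavinDerivative ⟨hX.toL2 t, h⟩ = R.constantField t := by
  have hgraph := (Submodule.span ℝ R.cylindricalGraph).topologicalClosure.toLinearPMap_graph_eq
    fun p hp h0 => R.snd_eq_zero_of_mem_closure_cylindricalGraph hX hp h0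
  have hmem : (hX.toL2 t, R.constantField t) ∈ R.malliavinDerivative.graph := by
    rw [malliavinDerivative, hgraph]
    exact Submodule.le_topologicalClosure _ (Submodule.subset_span (R.mem_cylindricalGraph hX t))
  obtain ⟨y, hy1, hy2⟩ := (LinearPMap.mem_graph_iff _).1 hmem
  obtain ⟨y, hy⟩ := y
  subst hy1
  exact ⟨hy, hy2⟩

theorem pastProjection_constantField_ae (s t : TimeInterval T) :
    R.pastProjection s (R.constantField t) =ᵐ[P]
      fun _ => (R.kernel.pastSpace s).starProjection (R.kernel.representer t) := by
  filter_upwards [ContinuousLinearMap.coeFn_compLpL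
    ((R.kernel.pastSpace s).starProjection) (R.constantField t), R.coeFn_constantField t]
    with ω h1 h2
  rw [← h2]
  exact h1

/-- The past space at `t` includes the endpoint, so `k_t` is one of its generators. -/
theorem pastProjection_constantField (t : TimeInterval T) :
    R.pastProjection t (R.constantField t) = R.constantField t := by
  refine Lp.ext ?_
  filter_upwards [R.pastProjection_constantField_ae t t, R.coeFn_constantField t] with ω h1 h2
  rw [h1, h2]
  exact Submodule.starProjection_eq_self_iff.2
    (Submodule.le_topologicalClosure _ (Submodule.subset_span ⟨t, Set.mem_Iic.2 le_rfl, rfl⟩))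

/-- Each past projection of a deterministic field is deterministic, hence measurable for any
σ-algebra, whatever the filtration. -/
theorem predictableProjection_constantField (t : TimeInterval T) :
    R.predictableProjection (R.constantField t) = R.constantField t := by
  refine Submodule.starProjection_eq_self_iff.2 (Submodule.le_topologicalClosure _ ?_)
  rw [Submodule.mem_iInf]
  intro s
  rw [Submodule.mem_comap]
  refine mem_lpMeas_iff_aestronglyMeasurable.2 ?_
  exact (aestronglyMeasurable_const (m := R.filtration s)).congr
    (R.pastProjection_constantField_ae s t).symm

theorem causalProjections_constantField {proj : TimeInterval T → R.Fields →L[ℝ] R.Fields}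
    (hproj : proj ∈ R.causalProjections) (t : TimeInterval T) :
    proj t (R.constantField t) = R.constantField t := by
  rcases hproj with rfl | rfl
  · exact R.pastProjection_constantField t
  · exact R.predictableProjection_constantField t

theorem energyField_eq (hX : IsFBMType P H X)
    {proj : TimeInterval T → R.Fields →L[ℝ] R.Fields} (hproj : proj ∈ R.causalProjections)
    (t : TimeInterval T) :
    energyField R.malliavinDerivative proj hX.toL2 t = R.constantField t := by
  obtain ⟨h, e⟩ := R.malliavinDerivative_toL2 hX t
  rw [energyField, dif_pos h, e, R.causalProjections_constantField hproj]

theorem continuous_constantField (hX : IsFBMType P H X) (hH : 0 < H) :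
    Continuous R.constantField :=
  (Lp.constL 2 P ℝ : R.kernel.cameronMartin →L[ℝ] R.Fields).continuous.comp
    (R.continuous_representer hX hH)

theorem hasIntrinsicBracket (hX : IsFBMType P H X) (hH : 0 < H)
    {proj : TimeInterval T → R.Fields →L[ℝ] R.Fields} (hproj : proj ∈ R.causalProjections) :
    HasIntrinsicBracket R.malliavinDerivative proj hX.toL2 := by
  refine ⟨fun t => (R.malliavinDerivative_toL2 hX t).1, ?_⟩
  rw [show energyField R.malliavinDerivative proj hX.toL2 = R.constantField from
    funext (R.energyField_eq hX hproj)]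
  exact (R.continuous_constantField hX hH).memLp_of_hasCompactSupport
    (HasCompactSupport.of_compactSpace _)

theorem intrinsicBracket_ae_eq (hX : IsFBMType P H X) (hH : 0 < H)
    {proj : TimeInterval T → R.Fields →L[ℝ] R.Fields} (hproj : proj ∈ R.causalProjections)
    (t : TimeInterval T) :
    intrinsicBracket R.malliavinDerivative proj hX.toL2 t =ᵐ[P] fun _ => (t : ℝ) ^ (2 * H) := by
  filter_upwards [R.coeFn_constantField t] with ω hω
  rw [intrinsicBracket, R.energyField_eq hX hproj, hω, R.norm_representer_sq hX hH]

end VolterraRepresentation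

end

theorem proposition8p2 {Ω : Type*} [MeasurableSpace Ω] (P : Measure Ω) [IsProbabilityMeasure P]
    (T H : ℝ) (hT : 0 < T) (hH : H ∈ Set.Ioo (0 : ℝ) 1)
    (X : TimeInterval T → Ω → ℝ) (hX : IsFBMType P H X) :
    (∀ R : VolterraRepresentation P X, ∀ proj ∈ R.causalProjections,
      HasIntrinsicBracket R.malliavinDerivative proj hX.toL2 ∧
      (∀ t : TimeInterval T,
        intrinsicBracket R.malliavinDerivative proj hX.toL2 t =ᵐ[P] fun _ => (t : ℝ) ^ (2 * H)) ∧
      (∀ γ : ℝ → ℝ,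
        (∀ t : TimeInterval T,
          intrinsicBracket R.malliavinDerivative proj hX.toL2 t =ᵐ[P] fun _ => γ t) →
        ∀ H' : ℝ, Asymptotics.IsEquivalent (𝓝[>] (0 : ℝ)) γ (fun t => t ^ (2 * H')) ↔ H' = H)) ∧
    (∀ R₁ R₂ : VolterraRepresentation P X,
      ∀ proj₁ ∈ R₁.causalProjections, ∀ proj₂ ∈ R₂.causalProjections, ∀ t : TimeInterval T,
        intrinsicBracket R₁.malliavinDerivative proj₁ hX.toL2 t =ᵐ[P]
          intrinsicBracket R₂.malliavinDerivative proj₂ hX.toL2 t) := by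
  refine ⟨fun R proj hproj => ⟨R.hasIntrinsicBracket hX hH.1 hproj,
    R.intrinsicBracket_ae_eq hX hH.1 hproj, fun γ hγ H' => ?_⟩,
    fun R₁ R₂ proj₁ h₁ proj₂ h₂ t => (R₁.intrinsicBracket_ae_eq hX hH.1 h₁ t).trans
      (R₂.intrinsicBracket_ae_eq hX hH.1 h₂ t).symm⟩
  -- Constants that agree almost surely under a probability measure are equal.
  have hval : ∀ t : TimeInterval T, γ t = (t : ℝ) ^ (2 * H) := fun t => by
    obtain ⟨ω, hω⟩ := ((hγ t).symm.trans (R.intrinsicBracket_ae_eq hX hH.1 hproj t)).exists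
    exact hω
  -- Outside `[0, T]` nothing is known about `γ`, but `(0, T]` is a right neighbourhood of `0`
  -- because `T > 0`.
  have hev : γ =ᶠ[𝓝[>] (0 : ℝ)] fun t => t ^ (2 * H) := by
    filter_upwards [Ioc_mem_nhdsGT hT] with t ht
    exact hval ⟨t, ht.1.le, ht.2⟩
  have hiff : Asymptotics.IsEquivalent (𝓝[>] (0 : ℝ)) γ (fun t => t ^ (2 * H')) ↔
      Asymptotics.IsEquivalent (𝓝[>] (0 : ℝ)) (fun t : ℝ => t ^ (2 * H))
        (fun t => t ^ (2 * H')) :=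
    ⟨fun h => h.congr_left hev, fun h => h.congr_left hev.symm⟩
  rw [hiff, isEquivalent_rpow_rpow_nhdsGT_zero_iff]
  constructor <;> intro h <;> linarith
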